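/- Let $\Omega=\{\mathbf t=(t_1,t_2,t_3)\in\mathbb R^3:\ t_1+t_2+t_3=0,\ -1\le t_1,\,t_2,\,-t_3<1\}$ be the regular hexagon in homogeneous coordinates, and let $d\mathbf t=dt_1\,dt_2$ be the area measure on the plane $t_1+t_2+t_3=0$. For a natural number $k$ let $\mathbb H_k=\{\mathbf j=(j_1,j_2,j_3)\in\mathbb Z^3:\ j_1+j_2+j_3=0,\ -k\le j_1,j_2,j_3\le k\}$ and $$D_k(\mathbf t)=\sum_{\mathbf j\in\mathbb H_k}e^{\frac{2\pi i}{3}(j_1t_1+j_2t_2+j_3t_3)} .$$ For $\alpha>-1$ and $n\ge 0$ let $$A_n^{\alpha}=\binom{n+\alpha}{\alpha}=\frac{\Gamma(n+\alpha+1)}{\Gamma(\alpha+1)\,\Gamma(n+1)},$$ and for $\delta>0$ let $$K_n^{(\delta)}(\mathbf t)=\frac1{A_n^{\delta}}\sum_{k=0}^{n}A_{n-k}^{\delta-1}D_k(\mathbf t)$$ be the hexagonal Cesàro $(C,\delta)$ kernel. **Theorem.** For every $0<\delta<1$ there is a constant $C>0$, depending only on $\delta$, such that for every integer $n\ge 1$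 the kernel $K_n^{(\delta)}$ is integrable on $\Omega$ and $$\int_{\Omega}\bigl|K_n^{(\delta)}(\mathbf t)\bigr|\,d\mathbf t\le C\log(n+1).$$ -/

import Mathlib

open MeasureTheory

noncomputable section

namespace HexagonalFourier

/-- The generalized binomial coefficient `x choose y` for real `x`, `y`, by the Gamma function. -/
def binomial (x y : ℝ) : ℝ :=
  Real.Gamma (x + 1) / (Real.Gamma (y + 1) * Real.Gamma (x - y + 1))

/-- The Cesàro numbers `A_n^α = (n + α choose α)`, for `α > -1`. -/
def cesaroNumber (α : ℝ) (n : ℕ) : ℝ :=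
  binomial ((n : ℝ) + α) α

/-- The half-open regular hexagon in homogeneous coordinates, a subset of the plane
`t₁ + t₂ + t₃ = 0` in `ℝ³`. The coordinates `t₁, t₂, t₃` are `t 0, t 1, t 2`. -/
def hexagon : Set (Fin 3 → ℝ) :=
  {t | t 0 + t 1 + t 2 = 0 ∧ (-1 ≤ t 0 ∧ t 0 < 1) ∧ (-1 ≤ t 1 ∧ t 1 < 1) ∧
    (-1 ≤ -t 2 ∧ -t 2 < 1)}

/-- The area measure `dt = dt₁ dt₂` of the plane `t₁ + t₂ + t₃ = 0` (as a measure on `ℝ³`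
carried by that plane): the image of the Lebesgue measure of `ℝ²` under the parametrization
`(t₁, t₂) ↦ (t₁, t₂, -t₁ - t₂)`. -/
def planeMeasure : Measure (Fin 3 → ℝ) :=
  Measure.map (fun p : ℝ × ℝ => ![p.1, p.2, -p.1 - p.2]) volume

/-- The integer points `j` with `j₁ + j₂ + j₃ = 0` and `-n ≤ j₁, j₂, j₃ ≤ n`. -/
def hexIndex (n : ℕ) : Finset (Fin 3 → ℤ) :=
  (Fintype.piFinset fun _ => Finset.Icc (-(n : ℤ)) (n : ℤ)).filter fun j => j 0 + j 1 + j 2 = 0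

/-- The exponentials `φ_j(t) = exp ((2 π i / 3) ⟨j, t⟩)`. -/
def phi (j : Fin 3 → ℤ) (t : Fin 3 → ℝ) : ℂ :=
  Complex.exp (2 * (Real.pi : ℂ) * Complex.I / 3 * ((∑ i, (j i : ℝ) * t i : ℝ) : ℂ))

/-- The hexagonal Dirichlet kernel `D_n`. -/
def dirichletKernel (n : ℕ) (t : Fin 3 → ℝ) : ℂ :=
  ∑ j ∈ hexIndex n, phi j t

/-- The hexagonal Cesàro `(C, δ)` kernel
`K_n^(δ) = (1 / A_n^δ) ∑_{k=0}^n A_{n-k}^{δ-1} D_k`. -/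
def cesaroKernel (δ : ℝ) (n : ℕ) (t : Fin 3 → ℝ) : ℂ :=
  (1 / (cesaroNumber δ n : ℂ)) *
    ∑ k ∈ Finset.range (n + 1), (cesaroNumber (δ - 1) (n - k) : ℂ) * dirichletKernel k t

end HexagonalFourier

end

/-!
The proof is by a pointwise bound for the kernel, valid on the whole hexagon.

Put `e(s) = exp (2 π i s / 3)` and `x = e(t₁ - t₃)`, `y = e(t₂ - t₁)`, `z = e(t₃ - t₂)`, so that
`x y z = 1`. The index hexagon is the projection along `(1, 1, 1)` of the cube `[0, k]³` without
`[1, k]³`, and therefore `D_k` is a difference of two products of three geometric sums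
(`dirichletKernel_eq_geom_sum`). This gives (`dirichletKernel_mul`)
`D_k (x - 1) (y - 1) (z - 1) = ∑ (a - 1) (a ^ k + a ^ (-k - 1))`, the sum being over `a = x, y, z`.

The Cesàro weights `A_j^{δ-1}` are positive and decreasing with partial sums `A_n^δ`, which is of
the order of `n ^ δ`. Splitting `∑ A_j^{δ-1} a ^ j` at `j ≈ 1 / ‖a - 1‖` and summing by parts beyond
that point bounds it by a multiple of `‖a - 1‖ ^ (-δ)` (`norm_sum_cesaroNumber_le`). With
`X = ‖x - 1‖`, and `Y`, `Z` likewise, the kernel is thus at most a constant times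
`n ^ (-δ) (X ^ (1 - δ) + Y ^ (1 - δ) + Z ^ (1 - δ)) / (X Y Z)` (`norm_cesaroKernel_mul_le`).

From `x y z = 1` it follows that `X`, `Y`, `Z` satisfy the triangle inequalities, so the two larger
ones are comparable. If `X` is the smallest, the bound becomes `n ^ (-δ) X⁻¹ Y ^ (-1 - δ)`. On the
hexagon `X` is comparable with `|t₁ - t₃|`, and so on, since the only zeros there of the three sines
are at `0`. Together with the trivial bound `O(n ^ 2)`, used where a difference of coordinates is at
most `n ^ (-2)` or all of them are `O(1 / n)`, this yields a majorant that is a sum of products of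
functions of one variable (`enorm_cesaroKernel_le`). Its integral is `O(log (n + 1))`: the logarithm
comes from integrating `|u|⁻¹` over `n ^ (-2) ≤ |u| ≤ 2`, and the integral of `|v| ^ (-1 - δ)` over
`|v| ≥ 1 / n` is `O(n ^ δ)`, which cancels the factor `n ^ (-δ)` (`lintegral_majorant_le`).
-/

namespace HexagonalFourier

/-! ### Cesàro numbers -/

lemma cesaroNumber_eq (α : ℝ) (n : ℕ) :
    cesaroNumber α n =
      Real.Gamma (n + α + 1) / (Real.Gamma (α + 1) * Real.Gamma (n + 1)) := by
  simp only [cesaroNumber, binomial]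
  congr 3
  ring

lemma cesaroNumber_zero {α : ℝ} (hα : -1 < α) : cesaroNumber α 0 = 1 := by
  have h : Real.Gamma (α + 1) ≠ 0 := (Real.Gamma_pos_of_pos (by linarith)).ne'
  simp [cesaroNumber_eq, h]

lemma cesaroNumber_succ {α : ℝ} (hα : -1 < α) (n : ℕ) :
    cesaroNumber α (n + 1) = cesaroNumber α n * ((n + 1 + α) / (n + 1)) := by
  have hn : (0 : ℝ) ≤ n := n.cast_nonneg
  have h₁ : Real.Gamma (α + 1) ≠ 0 := (Real.Gamma_pos_of_pos (by linarith)).ne'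
  have h₂ : Real.Gamma ((n : ℝ) + 1) ≠ 0 := (Real.Gamma_pos_of_pos (by linarith)).ne'
  rw [cesaroNumber_eq, cesaroNumber_eq]
  push_cast
  rw [show (n : ℝ) + 1 + α + 1 = (n + α + 1) + 1 by ring,
    Real.Gamma_add_one (show (n : ℝ) + α + 1 ≠ 0 by linarith),
    Real.Gamma_add_one (show (n : ℝ) + 1 ≠ 0 by linarith)]
  field_simp
  ring

lemma cesaroNumber_pos {α : ℝ} (hα : -1 < α) (n : ℕ) : 0 < cesaroNumber α n := by
  induction n with
  | zero => simp [cesaroNumber_zero hα]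
  | succ n ih =>
    rw [cesaroNumber_succ hα]
    have hn : (0 : ℝ) ≤ n := n.cast_nonneg
    exact mul_pos ih (div_pos (by linarith) (by linarith))

lemma cesaroNumber_sub_one {δ : ℝ} (hδ : 0 < δ) (n : ℕ) :
    cesaroNumber (δ - 1) n = cesaroNumber δ n * (δ / (n + δ)) := by
  induction n with
  | zero => simp [cesaroNumber_zero (show -1 < δ - 1 by linarith),
      cesaroNumber_zero (show -1 < δ by linarith), hδ.ne']
  | succ n ih =>
    have hn : (0 : ℝ) ≤ n := n.cast_nonneg
    have h₁ : (n : ℝ) + δ ≠ 0 := by linarith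
    have h₂ : (n : ℝ) + 1 + δ ≠ 0 := by linarith
    rw [cesaroNumber_succ (by linarith), cesaroNumber_succ (by linarith), ih]
    push_cast
    field_simp
    ring

lemma sum_cesaroNumber_sub_one {δ : ℝ} (hδ : 0 < δ) (n : ℕ) :
    ∑ k ∈ Finset.range (n + 1), cesaroNumber (δ - 1) k = cesaroNumber δ n := by
  induction n with
  | zero => simp [cesaroNumber_zero (show -1 < δ - 1 by linarith),
      cesaroNumber_zero (show -1 < δ by linarith)]
  | succ n ih =>
    have hn : (0 : ℝ) ≤ n := n.cast_nonneg
    have h₂ : (n : ℝ) + 1 + δ ≠ 0 := by linarith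
    rw [Finset.sum_range_succ, ih, cesaroNumber_sub_one hδ,
      cesaroNumber_succ (show -1 < δ by linarith)]
    push_cast
    field_simp

lemma antitone_cesaroNumber_sub_one {δ : ℝ} (hδ0 : 0 < δ) (hδ1 : δ < 1) :
    Antitone (cesaroNumber (δ - 1)) := by
  refine antitone_nat_of_succ_le fun n => ?_
  have hn : (0 : ℝ) ≤ n := n.cast_nonneg
  rw [cesaroNumber_succ (by linarith)]
  refine mul_le_of_le_one_right (cesaroNumber_pos (by linarith) n).le ?_
  rw [div_le_one (by linarith)]
  linarith

/-- Bernoulli's inequality `(1 + 1 / k) ^ δ ≤ 1 + δ / k`, multiplied over `k ≤ n`. -/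
lemma rpow_le_cesaroNumber {δ : ℝ} (hδ0 : 0 < δ) (hδ1 : δ < 1) (n : ℕ) :
    ((n : ℝ) + 1) ^ δ ≤ cesaroNumber δ n := by
  induction n with
  | zero => simp [cesaroNumber_zero (show -1 < δ by linarith)]
  | succ n ih =>
    have hn : (0 : ℝ) < (n : ℝ) + 1 := n.cast_add_one_pos
    have hk : 0 < 1 / ((n : ℝ) + 1) := by positivity
    have hB : (1 + 1 / ((n : ℝ) + 1)) ^ δ ≤ 1 + δ * (1 / ((n : ℝ) + 1)) :=
      rpow_one_add_le_one_add_mul_self (by linarith) hδ0.le hδ1.le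
    have hA := (cesaroNumber_pos (show -1 < δ by linarith) n).le
    rw [cesaroNumber_succ (by linarith)]
    calc (((n + 1 : ℕ) : ℝ) + 1) ^ δ = (((n : ℝ) + 1) * (1 + 1 / ((n : ℝ) + 1))) ^ δ := by
          congr 1; push_cast; field_simp
      _ = ((n : ℝ) + 1) ^ δ * (1 + 1 / ((n : ℝ) + 1)) ^ δ :=
          Real.mul_rpow hn.le (by positivity)
      _ ≤ cesaroNumber δ n * (1 + δ * (1 / ((n : ℝ) + 1))) := by
          gcongr
      _ = cesaroNumber δ n * ((n + 1 + δ) / (n + 1)) := by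
          congr 1; field_simp

/-- Bernoulli's inequality `(1 - 1 / k) ^ δ ≤ 1 - δ / k ≤ (1 + δ / k)⁻¹`, multiplied over
`2 ≤ k ≤ n`. -/
lemma cesaroNumber_le_rpow {δ : ℝ} (hδ0 : 0 < δ) (hδ1 : δ < 1) {n : ℕ} (hn : 1 ≤ n) :
    cesaroNumber δ n ≤ 2 * (n : ℝ) ^ δ := by
  induction n, hn using Nat.le_induction with
  | base =>
    have := cesaroNumber_succ (show -1 < δ by linarith) 0
    rw [zero_add, cesaroNumber_zero (by linarith)] at this
    rw [this]
    simp
    linarith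
  | succ n hn ih =>
    have hn0 : (0 : ℝ) < n := by exact_mod_cast hn
    have hn' : (0 : ℝ) < (n : ℝ) + 1 := by linarith
    have hk : 1 / ((n : ℝ) + 1) ≤ 1 := by rw [div_le_one hn']; linarith
    have hB : (1 + -(1 / ((n : ℝ) + 1))) ^ δ ≤ 1 + δ * -(1 / ((n : ℝ) + 1)) :=
      rpow_one_add_le_one_add_mul_self (by linarith) hδ0.le hδ1.le
    have hq : (n : ℝ) ^ δ = ((n : ℝ) + 1) ^ δ * (1 + -(1 / ((n : ℝ) + 1))) ^ δ := by
      rw [← Real.mul_rpow hn'.le (by linarith)]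
      congr 1; field_simp; ring
    have hs : (1 + δ * -(1 / ((n : ℝ) + 1))) * ((n + 1 + δ) / (n + 1)) ≤ 1 := by
      have : (1 + δ * -(1 / ((n : ℝ) + 1))) * ((n + 1 + δ) / (n + 1))
          = 1 - (δ / (n + 1)) ^ 2 := by field_simp; ring
      rw [this]
      nlinarith [sq_nonneg (δ / ((n : ℝ) + 1))]
    rw [cesaroNumber_succ (by linarith)]
    calc cesaroNumber δ n * ((n + 1 + δ) / (n + 1))
        ≤ (2 * (n : ℝ) ^ δ) * ((n + 1 + δ) / (n + 1)) := by gcongr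
      _ = 2 * ((n : ℝ) + 1) ^ δ * ((1 + -(1 / ((n : ℝ) + 1))) ^ δ * ((n + 1 + δ) / (n + 1))) := by
          rw [hq]; ring
      _ ≤ 2 * ((n : ℝ) + 1) ^ δ * 1 := by
          gcongr
          exact le_trans (by gcongr) hs
      _ = 2 * (((n + 1 : ℕ) : ℝ)) ^ δ := by push_cast; ring

/-! ### Exponential sums with Cesàro weights -/

/-- Summation by parts against a monotone weight. -/
lemma norm_sub_one_mul_sum_le {a : ℕ → ℝ} (ha : Antitone a) (ha0 : ∀ n, 0 ≤ a n) {x : ℂ}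
    (hx : ‖x‖ = 1) (m : ℕ) :
    ‖(x - 1) * ∑ j ∈ Finset.range m, (a j : ℂ) * x ^ j‖ ≤ 2 * a 0 := by
  have key : ‖(x - 1) * ∑ j ∈ Finset.range m, (a j : ℂ) * x ^ j - a m * x ^ m‖
      ≤ 2 * a 0 - a m := by
    induction m with
    | zero => simp [abs_of_nonneg (ha0 0)]; linarith
    | succ m ih =>
      have h : (x - 1) * ∑ j ∈ Finset.range (m + 1), (a j : ℂ) * x ^ j - a (m + 1) * x ^ (m + 1)
          = ((x - 1) * ∑ j ∈ Finset.range m, (a j : ℂ) * x ^ j - a m * x ^ m)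
            + ((a m - a (m + 1) : ℝ) : ℂ) * x ^ (m + 1) := by
        rw [Finset.sum_range_succ]; push_cast; ring
      have hd : ‖((a m - a (m + 1) : ℝ) : ℂ) * x ^ (m + 1)‖ = a m - a (m + 1) := by
        rw [norm_mul, norm_pow, hx, one_pow, mul_one, Complex.norm_real, Real.norm_of_nonneg]
        linarith [ha (Nat.le_succ m)]
      rw [h]
      linarith [norm_add_le ((x - 1) * ∑ j ∈ Finset.range m, (a j : ℂ) * x ^ j - a m * x ^ m)
        (((a m - a (m + 1) : ℝ) : ℂ) * x ^ (m + 1))]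
  have hm : ‖(a m : ℂ) * x ^ m‖ = a m := by
    rw [norm_mul, norm_pow, hx, one_pow, mul_one, Complex.norm_real, Real.norm_of_nonneg (ha0 m)]
  linarith [norm_sub_norm_le ((x - 1) * ∑ j ∈ Finset.range m, (a j : ℂ) * x ^ j) (a m * x ^ m)]

lemma norm_sum_cesaroNumber_le_cesaroNumber {δ : ℝ} (hδ0 : 0 < δ) {x : ℂ} (hx : ‖x‖ = 1)
    {m N : ℕ} (hm : m ≤ N + 1) :
    ‖∑ j ∈ Finset.range m, (cesaroNumber (δ - 1) j : ℂ) * x ^ j‖ ≤ cesaroNumber δ N := by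
  have hA : ∀ j, 0 < cesaroNumber (δ - 1) j := cesaroNumber_pos (by linarith)
  calc ‖∑ j ∈ Finset.range m, (cesaroNumber (δ - 1) j : ℂ) * x ^ j‖
      ≤ ∑ j ∈ Finset.range m, cesaroNumber (δ - 1) j := by
        refine norm_sum_le_of_le _ fun j _ => le_of_eq ?_
        rw [norm_mul, norm_pow, hx, one_pow, mul_one, Complex.norm_real,
          Real.norm_of_nonneg (hA j).le]
    _ ≤ ∑ j ∈ Finset.range (N + 1), cesaroNumber (δ - 1) j :=
        Finset.sum_le_sum_of_subset_of_nonneg (Finset.range_mono hm) fun j _ _ => (hA j).le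
    _ = cesaroNumber δ N := sum_cesaroNumber_sub_one hδ0 N

/-- The sum is split at `N ≈ 1 / ‖x - 1‖`: the terms below `N` are estimated by their absolute
values, the others by summation by parts. -/
lemma norm_sum_cesaroNumber_le {δ : ℝ} (hδ0 : 0 < δ) (hδ1 : δ < 1) {x : ℂ} (hx : ‖x‖ = 1)
    (hx1 : x ≠ 1) (m : ℕ) :
    ‖∑ j ∈ Finset.range m, (cesaroNumber (δ - 1) j : ℂ) * x ^ j‖ ≤ 18 * ‖x - 1‖ ^ (-δ) := by
  set X := ‖x - 1‖ with hX
  have hX0 : 0 < X := norm_pos_iff.2 (sub_ne_zero.2 hx1)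
  have hX2 : X ≤ 2 := by
    have := norm_sub_le x 1
    rw [hx, norm_one] at this
    linarith
  have hA : ∀ j, 0 < cesaroNumber (δ - 1) j := cesaroNumber_pos (by linarith)
  set N := ⌈1 / X⌉₊ with hN
  have hN1 : 1 ≤ N := Nat.one_le_ceil_iff.2 (by positivity)
  have hNlow : 1 / X ≤ N := Nat.le_ceil _
  have hNpos : (0 : ℝ) < N := by exact_mod_cast hN1
  have hNup : (N : ℝ) ≤ 3 / X := by
    have h1 : (N : ℝ) < 1 / X + 1 := Nat.ceil_lt_add_one (by positivity)
    have h2 : (3 : ℝ) / X = 1 / X + 2 / X := by ring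
    have h3 : 1 ≤ 2 / X := by rwa [le_div_iff₀ hX0, one_mul]
    linarith
  have hNδ : (N : ℝ) ^ δ ≤ 3 * X ^ (-δ) := by
    calc (N : ℝ) ^ δ ≤ (3 / X) ^ δ := Real.rpow_le_rpow hNpos.le hNup hδ0.le
      _ = 3 ^ δ * X ^ (-δ) := by
          rw [Real.div_rpow (by norm_num) hX0.le, Real.rpow_neg hX0.le]; rfl
      _ ≤ 3 * X ^ (-δ) := by
          gcongr
          calc (3 : ℝ) ^ δ ≤ 3 ^ (1 : ℝ) :=
                Real.rpow_le_rpow_of_exponent_le (by norm_num) hδ1.le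
            _ = 3 := Real.rpow_one 3
  have hAN : cesaroNumber δ N ≤ 6 * X ^ (-δ) := by
    linarith [cesaroNumber_le_rpow hδ0 hδ1 hN1]
  have hXδ : 0 ≤ X ^ (-δ) := by positivity
  rcases le_total m N with hm | hm
  · have := norm_sum_cesaroNumber_le_cesaroNumber hδ0 hx (hm.trans N.le_succ)
    linarith
  · obtain ⟨r, rfl⟩ := Nat.exists_eq_add_of_le hm
    have h1 := norm_sum_cesaroNumber_le_cesaroNumber hδ0 hx N.le_succ
    have h2 : ‖∑ j ∈ Finset.range r, (cesaroNumber (δ - 1) (N + j) : ℂ) * x ^ j‖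
        ≤ 12 * X ^ (-δ) := by
      have h3 := norm_sub_one_mul_sum_le (a := fun j => cesaroNumber (δ - 1) (N + j))
        (fun i j hij => antitone_cesaroNumber_sub_one hδ0 hδ1 (Nat.add_le_add_left hij N))
        (fun j => (hA _).le) hx r
      rw [norm_mul, ← hX] at h3
      have h4 : cesaroNumber (δ - 1) N ≤ 6 * X ^ (-δ) * X := by
        rw [cesaroNumber_sub_one hδ0]
        refine mul_le_mul hAN ?_ (by positivity) (by positivity)
        rw [div_le_iff₀ (by positivity)]
        rw [div_le_iff₀ hX0] at hNlow
        nlinarith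
      refine le_of_mul_le_mul_left ?_ hX0
      simp only [add_zero] at h3
      linarith
    rw [Finset.sum_range_add]
    have h5 : ∑ j ∈ Finset.range r, (cesaroNumber (δ - 1) (N + j) : ℂ) * x ^ (N + j)
        = x ^ N * ∑ j ∈ Finset.range r, (cesaroNumber (δ - 1) (N + j) : ℂ) * x ^ j := by
      rw [Finset.mul_sum]
      exact Finset.sum_congr rfl fun j _ => by rw [pow_add]; ring
    have h6 : ‖x ^ N * ∑ j ∈ Finset.range r, (cesaroNumber (δ - 1) (N + j) : ℂ) * x ^ j‖
        ≤ 12 * X ^ (-δ) := by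
      rw [norm_mul, norm_pow, hx, one_pow, one_mul]; exact h2
    rw [h5]
    refine (norm_add_le _ _).trans ?_
    linarith

lemma norm_inv_sub_one {x : ℂ} (hx : ‖x‖ = 1) : ‖x⁻¹ - 1‖ = ‖x - 1‖ := by
  have hx0 : x ≠ 0 := norm_ne_zero_iff.1 (by rw [hx]; norm_num)
  rw [show x⁻¹ - 1 = -(x⁻¹ * (x - 1)) by field_simp; ring, norm_neg, norm_mul, norm_inv, hx,
    inv_one, one_mul]

lemma norm_sum_cesaroNumber_reflect_le {δ : ℝ} (hδ0 : 0 < δ) (hδ1 : δ < 1) {x : ℂ}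
    (hx : ‖x‖ = 1) (hx1 : x ≠ 1) (n : ℕ) :
    ‖∑ k ∈ Finset.range (n + 1), (cesaroNumber (δ - 1) (n - k) : ℂ) * x ^ k‖
      ≤ 18 * ‖x - 1‖ ^ (-δ) := by
  have hx0 : x ≠ 0 := norm_ne_zero_iff.1 (by rw [hx]; norm_num)
  have h1 : ∑ k ∈ Finset.range (n + 1), (cesaroNumber (δ - 1) (n - k) : ℂ) * x ^ k
      = x ^ n * ∑ j ∈ Finset.range (n + 1), (cesaroNumber (δ - 1) j : ℂ) * x⁻¹ ^ j := by
    rw [← Finset.sum_range_reflect, Finset.mul_sum]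
    refine Finset.sum_congr rfl fun j hj => ?_
    have hj' : j ≤ n := Nat.lt_succ_iff.1 (Finset.mem_range.1 hj)
    rw [show n + 1 - 1 - j = n - j by omega, Nat.sub_sub_self hj', pow_sub₀ x hx0 hj', inv_pow]
    ring
  rw [h1, norm_mul, norm_pow, hx, one_pow, one_mul, ← norm_inv_sub_one hx]
  exact norm_sum_cesaroNumber_le hδ0 hδ1 (by rw [norm_inv, hx, inv_one]) (by simpa using hx1) _

/-! ### The Dirichlet kernel in closed form -/

/-- The character `s ↦ exp (2 π i s / 3)`. -/
noncomputable def expThird (s : ℝ) : ℂ :=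
  Complex.exp (Complex.I * ((2 * Real.pi / 3 * s : ℝ) : ℂ))

lemma norm_expThird (s : ℝ) : ‖expThird s‖ = 1 := by
  rw [expThird, mul_comm]
  exact Complex.norm_exp_ofReal_mul_I _

lemma expThird_ne_zero (s : ℝ) : expThird s ≠ 0 := Complex.exp_ne_zero _

lemma expThird_mul_mul {u v w : ℝ} (h : u + v + w = 0) :
    expThird u * expThird v * expThird w = 1 := by
  obtain rfl : w = -u - v := by linarith
  simp only [expThird]
  rw [← Complex.exp_add, ← Complex.exp_add, ← Complex.exp_zero]
  congr 1
  push_cast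
  ring

lemma phi_sub (p q r : ℕ) (t : Fin 3 → ℝ) :
    phi ![(p : ℤ) - q, (q : ℤ) - r, (r : ℤ) - p] t =
      expThird (t 0 - t 2) ^ p * expThird (t 1 - t 0) ^ q * expThird (t 2 - t 1) ^ r := by
  simp only [phi, expThird]
  rw [← Complex.exp_nat_mul, ← Complex.exp_nat_mul, ← Complex.exp_nat_mul, ← Complex.exp_add,
    ← Complex.exp_add]
  congr 1
  simp [Fin.sum_univ_three]
  ring

/-- The hexagon is the projection along `(1, 1, 1)` of the part of the cube `[0, k]³` on the
three coordinate planes: `(p, q, r) ↦ (p - q, q - r, r - p)` is a bijection from the triples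
with `min p q r = 0` onto the index set. -/
lemma sum_hexIndex (k : ℕ) (F : (Fin 3 → ℤ) → ℂ) :
    ∑ j ∈ hexIndex k, F j =
      ∑ p ∈ (Finset.range (k + 1) ×ˢ Finset.range (k + 1) ×ˢ Finset.range (k + 1)).filter
        (fun p => ¬ (1 ≤ p.1 ∧ 1 ≤ p.2.1 ∧ 1 ≤ p.2.2)),
        F ![(p.1 : ℤ) - p.2.1, (p.2.1 : ℤ) - p.2.2, (p.2.2 : ℤ) - p.1] := by
  symm
  refine Finset.sum_bij
    (fun p _ => ![(p.1 : ℤ) - p.2.1, (p.2.1 : ℤ) - p.2.2, (p.2.2 : ℤ) - p.1]) ?_ ?_ ?_ ?_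
  · rintro ⟨p, q, r⟩ h
    simp only [Finset.mem_filter, Finset.mem_product, Finset.mem_range] at h
    simp only [hexIndex, Finset.mem_filter, Fintype.mem_piFinset, Finset.mem_Icc, Fin.forall_fin_succ,
      Matrix.cons_val_zero, Matrix.cons_val_one, Matrix.cons_val, Fin.succ_zero_eq_one,
      Fin.succ_one_eq_two, IsEmpty.forall_iff, and_true]
    omega
  · rintro ⟨p, q, r⟩ h ⟨p', q', r'⟩ h' he
    simp only [Finset.mem_filter, Finset.mem_product, Finset.mem_range] at h h'
    have h0 := congrFun he 0
    have h1 := congrFun he 1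
    simp only [Matrix.cons_val_zero, Matrix.cons_val_one] at h0 h1
    simp only [Prod.mk.injEq]
    omega
  · intro j hj
    simp only [hexIndex, Finset.mem_filter, Fintype.mem_piFinset, Finset.mem_Icc] at hj
    obtain ⟨hb, hs⟩ := hj
    have b0 := hb 0
    have b1 := hb 1
    have b2 := hb 2
    refine ⟨((max 0 (max (-j 1) (j 2)) - j 2).toNat, (max 0 (max (-j 1) (j 2)) + j 1).toNat,
      (max 0 (max (-j 1) (j 2))).toNat), ?_, ?_⟩
    · simp only [Finset.mem_filter, Finset.mem_product, Finset.mem_range]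
      omega
    · funext i
      fin_cases i
      all_goals
        simp only [Fin.zero_eta, Fin.mk_one, Fin.reduceFinMk, Matrix.cons_val_zero,
          Matrix.cons_val_one, Matrix.cons_val]
        omega
  · intros
    rfl

lemma dirichletKernel_eq_geom_sum (k : ℕ) (t : Fin 3 → ℝ) :
    dirichletKernel k t =
      (∑ p ∈ Finset.range (k + 1), expThird (t 0 - t 2) ^ p) *
        (∑ p ∈ Finset.range (k + 1), expThird (t 1 - t 0) ^ p) *
        (∑ p ∈ Finset.range (k + 1), expThird (t 2 - t 1) ^ p) -
      (∑ p ∈ Finset.range k, expThird (t 0 - t 2) ^ p) *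
        (∑ p ∈ Finset.range k, expThird (t 1 - t 0) ^ p) *
        (∑ p ∈ Finset.range k, expThird (t 2 - t 1) ^ p) := by
  have h1 := expThird_mul_mul (show (t 0 - t 2) + (t 1 - t 0) + (t 2 - t 1) = 0 by ring)
  set x := expThird (t 0 - t 2) with hx
  set y := expThird (t 1 - t 0) with hy
  set z := expThird (t 2 - t 1) with hz
  have cube : ∀ m : ℕ, (∑ p ∈ Finset.range m, x ^ p) * (∑ p ∈ Finset.range m, y ^ p) *
      (∑ p ∈ Finset.range m, z ^ p) =
      ∑ p ∈ Finset.range m ×ˢ Finset.range m ×ˢ Finset.range m,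
        x ^ p.1 * y ^ p.2.1 * z ^ p.2.2 := by
    intro m
    rw [mul_assoc, Finset.sum_mul_sum, Finset.sum_product]
    simp_rw [Finset.sum_mul_sum, Finset.sum_product, Finset.mul_sum, mul_assoc]
  -- Shifting by `(1, 1, 1)` does not change a term, as `x y z = 1`.
  have shift : ∑ p ∈ (Finset.range (k + 1) ×ˢ Finset.range (k + 1) ×ˢ Finset.range (k + 1)).filter
        (fun p => 1 ≤ p.1 ∧ 1 ≤ p.2.1 ∧ 1 ≤ p.2.2), x ^ p.1 * y ^ p.2.1 * z ^ p.2.2 =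
      ∑ p ∈ Finset.range k ×ˢ Finset.range k ×ˢ Finset.range k,
        x ^ p.1 * y ^ p.2.1 * z ^ p.2.2 := by
    refine Finset.sum_nbij' (fun p => (p.1 - 1, p.2.1 - 1, p.2.2 - 1))
      (fun p => (p.1 + 1, p.2.1 + 1, p.2.2 + 1)) ?_ ?_ ?_ ?_ ?_
    · rintro ⟨p, q, r⟩ h
      simp only [Finset.mem_filter, Finset.mem_product, Finset.mem_range] at h ⊢
      omega
    · rintro ⟨p, q, r⟩ h
      simp only [Finset.mem_filter, Finset.mem_product, Finset.mem_range] at h ⊢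
      omega
    · rintro ⟨p, q, r⟩ h
      simp only [Finset.mem_filter, Finset.mem_product, Finset.mem_range] at h
      simp only [Prod.mk.injEq]
      omega
    · rintro ⟨p, q, r⟩ h
      rfl
    · rintro ⟨p, q, r⟩ h
      simp only [Finset.mem_filter, Finset.mem_product, Finset.mem_range] at h
      obtain ⟨-, hp, hq, hr⟩ := h
      obtain ⟨p, rfl⟩ := Nat.exists_eq_add_of_le' hp
      obtain ⟨q, rfl⟩ := Nat.exists_eq_add_of_le' hq
      obtain ⟨r, rfl⟩ := Nat.exists_eq_add_of_le' hr
      simp only [Nat.add_sub_cancel, pow_succ]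
      linear_combination (x ^ p * y ^ q * z ^ r) * h1
  rw [cube, cube, ← shift, dirichletKernel, sum_hexIndex, eq_sub_iff_add_eq, add_comm,
    ← Finset.sum_filter_add_sum_filter_not
      (Finset.range (k + 1) ×ˢ Finset.range (k + 1) ×ˢ Finset.range (k + 1))
      (fun p => 1 ≤ p.1 ∧ 1 ≤ p.2.1 ∧ 1 ≤ p.2.2)]
  congr 1
  exact Finset.sum_congr rfl fun p _ => phi_sub _ _ _ _

lemma dirichletKernel_mul (k : ℕ) (t : Fin 3 → ℝ) {x y z : ℂ} (hx : x = expThird (t 0 - t 2))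
    (hy : y = expThird (t 1 - t 0)) (hz : z = expThird (t 2 - t 1)) :
    dirichletKernel k t * ((x - 1) * (y - 1) * (z - 1)) =
      (x - 1) * (x ^ k + x⁻¹ ^ (k + 1)) + (y - 1) * (y ^ k + y⁻¹ ^ (k + 1)) +
        (z - 1) * (z ^ k + z⁻¹ ^ (k + 1)) := by
  have h1 : x * y * z = 1 := by
    rw [hx, hy, hz]; exact expThird_mul_mul (by ring)
  have hx0 : x ≠ 0 := hx ▸ expThird_ne_zero _
  have hy0 : y ≠ 0 := hy ▸ expThird_ne_zero _
  have hz0 : z ≠ 0 := hz ▸ expThird_ne_zero _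
  have hprod : ∀ m : ℕ, (x ^ m - 1) * (y ^ m - 1) * (z ^ m - 1) =
      x ^ m + y ^ m + z ^ m - x⁻¹ ^ m - y⁻¹ ^ m - z⁻¹ ^ m := by
    intro m
    have hm : x ^ m * y ^ m * z ^ m = 1 := by rw [← mul_pow, ← mul_pow, h1, one_pow]
    have ex : x⁻¹ ^ m = y ^ m * z ^ m := by
      rw [inv_pow]; exact inv_eq_of_mul_eq_one_right (by rw [← hm]; ring)
    have ey : y⁻¹ ^ m = x ^ m * z ^ m := by
      rw [inv_pow]; exact inv_eq_of_mul_eq_one_right (by rw [← hm]; ring)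
    have ez : z⁻¹ ^ m = x ^ m * y ^ m := by
      rw [inv_pow]; exact inv_eq_of_mul_eq_one_right (by rw [← hm]; ring)
    rw [ex, ey, ez]
    linear_combination hm
  have hgeom : dirichletKernel k t * ((x - 1) * (y - 1) * (z - 1)) =
      (x ^ (k + 1) - 1) * (y ^ (k + 1) - 1) * (z ^ (k + 1) - 1) -
        (x ^ k - 1) * (y ^ k - 1) * (z ^ k - 1) := by
    rw [dirichletKernel_eq_geom_sum, ← hx, ← hy, ← hz]
    simp only [← geom_sum_mul]
    ring
  have hinv : ∀ a : ℂ, a ≠ 0 → a⁻¹ ^ k - a⁻¹ ^ (k + 1) = (a - 1) * a⁻¹ ^ (k + 1) := by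
    intro a ha
    rw [pow_succ]
    field_simp
  rw [hgeom, hprod, hprod]
  linear_combination hinv x hx0 + hinv y hy0 + hinv z hz0

/-! ### Pointwise bounds for the Cesàro kernel -/

lemma card_hexIndex_le (k : ℕ) : (hexIndex k).card ≤ (2 * k + 1) ^ 2 := by
  have h : (hexIndex k).card ≤
      (Finset.Icc (-(k : ℤ)) k ×ˢ Finset.Icc (-(k : ℤ)) k).card := by
    refine Finset.card_le_card_of_injOn (fun j => (j 0, j 1)) ?_ ?_
    · intro j hj
      simp only [hexIndex, Finset.coe_filter, Set.mem_ofPred_eq, Fintype.mem_piFinset] at hj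
      exact Finset.mem_coe.2 (Finset.mem_product.2 ⟨hj.1 0, hj.1 1⟩)
    · intro j hj j' hj' he
      simp only [hexIndex, Finset.coe_filter, Set.mem_ofPred_eq] at hj hj'
      simp only [Prod.mk.injEq] at he
      funext i
      fin_cases i
      all_goals
        simp only [Fin.zero_eta, Fin.mk_one, Fin.reduceFinMk]
        omega
  refine h.trans (le_of_eq ?_)
  rw [Finset.card_product, Int.card_Icc, sq]
  congr 1 <;> omega

lemma norm_phi (j : Fin 3 → ℤ) (t : Fin 3 → ℝ) : ‖phi j t‖ = 1 := by
  rw [phi, show 2 * (Real.pi : ℂ) * Complex.I / 3 * ((∑ i, (j i : ℝ) * t i : ℝ) : ℂ)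
    = ((2 * Real.pi / 3 * ∑ i, (j i : ℝ) * t i : ℝ) : ℂ) * Complex.I by push_cast; ring]
  exact Complex.norm_exp_ofReal_mul_I _

lemma norm_dirichletKernel_le (k : ℕ) (t : Fin 3 → ℝ) :
    ‖dirichletKernel k t‖ ≤ (2 * k + 1) ^ 2 := by
  calc ‖dirichletKernel k t‖ ≤ ∑ j ∈ hexIndex k, 1 :=
        norm_sum_le_of_le _ fun j _ => (norm_phi j t).le
    _ ≤ (2 * k + 1) ^ 2 := by
        rw [Finset.sum_const, nsmul_eq_mul, mul_one]
        exact_mod_cast card_hexIndex_le k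

lemma norm_cesaroKernel_le_sq {δ : ℝ} (hδ0 : 0 < δ) {n : ℕ} (hn : 1 ≤ n) (t : Fin 3 → ℝ) :
    ‖cesaroKernel δ n t‖ ≤ 9 * (n : ℝ) ^ 2 := by
  have hA := cesaroNumber_pos (show -1 < δ by linarith) n
  have hn' : (1 : ℝ) ≤ n := by exact_mod_cast hn
  have hsum : ‖∑ k ∈ Finset.range (n + 1),
      (cesaroNumber (δ - 1) (n - k) : ℂ) * dirichletKernel k t‖
      ≤ cesaroNumber δ n * (9 * (n : ℝ) ^ 2) := by
    calc _ ≤ ∑ k ∈ Finset.range (n + 1), cesaroNumber (δ - 1) (n - k) * (9 * (n : ℝ) ^ 2) := by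
          refine norm_sum_le_of_le _ fun k hk => ?_
          have hk' : (k : ℝ) ≤ n := by exact_mod_cast Nat.lt_succ_iff.1 (Finset.mem_range.1 hk)
          have hk0 : (0 : ℝ) ≤ k := k.cast_nonneg
          have hp := cesaroNumber_pos (show -1 < δ - 1 by linarith) (n - k)
          rw [norm_mul, Complex.norm_real, Real.norm_of_nonneg hp.le]
          refine mul_le_mul_of_nonneg_left ((norm_dirichletKernel_le k t).trans ?_) hp.le
          nlinarith
      _ = cesaroNumber δ n * (9 * (n : ℝ) ^ 2) := by
          rw [← Finset.sum_mul, ← sum_cesaroNumber_sub_one hδ0 n,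
            ← Finset.sum_range_reflect (fun k => cesaroNumber (δ - 1) k)]
          simp
  rw [cesaroKernel, norm_mul, norm_div, norm_one, Complex.norm_real, Real.norm_of_nonneg hA.le,
    one_div, inv_mul_le_iff₀ hA]
  exact hsum

lemma norm_cesaroKernel_mul_le {δ : ℝ} (hδ0 : 0 < δ) (hδ1 : δ < 1) {n : ℕ} (hn : 1 ≤ n)
    (t : Fin 3 → ℝ) {x y z : ℂ} (hx : x = expThird (t 0 - t 2))
    (hy : y = expThird (t 1 - t 0)) (hz : z = expThird (t 2 - t 1))
    (hx1 : x ≠ 1) (hy1 : y ≠ 1) (hz1 : z ≠ 1) :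
    ‖cesaroKernel δ n t‖ * (‖x - 1‖ * ‖y - 1‖ * ‖z - 1‖) ≤
      36 * (n : ℝ) ^ (-δ) * (‖x - 1‖ ^ (1 - δ) + ‖y - 1‖ ^ (1 - δ) + ‖z - 1‖ ^ (1 - δ)) := by
  have hn' : (0 : ℝ) < n := by exact_mod_cast hn
  have hA := cesaroNumber_pos (show -1 < δ by linarith) n
  have hAinv : (cesaroNumber δ n)⁻¹ ≤ (n : ℝ) ^ (-δ) := by
    rw [Real.rpow_neg hn'.le]
    refine inv_anti₀ (by positivity) (le_trans ?_ (rpow_le_cesaroNumber hδ0 hδ1 n))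
    exact Real.rpow_le_rpow hn'.le (by linarith) hδ0.le
  -- The contribution of one of the three characters to the closed form of the kernel.
  set S : ℂ → ℂ := fun a => ∑ k ∈ Finset.range (n + 1), (cesaroNumber (δ - 1) (n - k) : ℂ) *
    ((a - 1) * (a ^ k + a⁻¹ ^ (k + 1))) with hS
  have hSle : ∀ a : ℂ, ‖a‖ = 1 → a ≠ 1 → ‖S a‖ ≤ 36 * ‖a - 1‖ ^ (1 - δ) := by
    intro a ha ha1
    have ha0 : 0 < ‖a - 1‖ := norm_pos_iff.2 (sub_ne_zero.2 ha1)
    have hia : ‖a⁻¹‖ = 1 := by rw [norm_inv, ha, inv_one]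
    have e : S a = (a - 1) * (∑ k ∈ Finset.range (n + 1),
          (cesaroNumber (δ - 1) (n - k) : ℂ) * a ^ k + a⁻¹ * ∑ k ∈ Finset.range (n + 1),
          (cesaroNumber (δ - 1) (n - k) : ℂ) * a⁻¹ ^ k) := by
      rw [hS, Finset.mul_sum, ← Finset.sum_add_distrib, Finset.mul_sum]
      exact Finset.sum_congr rfl fun k _ => by rw [pow_succ]; ring
    have b1 := norm_sum_cesaroNumber_reflect_le hδ0 hδ1 ha ha1 n
    have b2 := norm_sum_cesaroNumber_reflect_le hδ0 hδ1 hia (by simpa using ha1) n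
    rw [norm_inv_sub_one ha] at b2
    rw [e, norm_mul]
    calc _ ≤ ‖a - 1‖ * (18 * ‖a - 1‖ ^ (-δ) + 18 * ‖a - 1‖ ^ (-δ)) := by
          gcongr
          refine (norm_add_le _ _).trans (add_le_add b1 ?_)
          rw [norm_mul, hia, one_mul]
          exact b2
      _ = 36 * ‖a - 1‖ ^ (1 - δ) := by
          rw [sub_eq_add_neg (1 : ℝ), Real.rpow_add ha0, Real.rpow_one]; ring
  have hK : cesaroKernel δ n t * ((x - 1) * (y - 1) * (z - 1)) =
      (1 / (cesaroNumber δ n : ℂ)) * (S x + S y + S z) := by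
    rw [cesaroKernel, mul_assoc, hS]
    simp only
    rw [Finset.sum_mul, ← Finset.sum_add_distrib, ← Finset.sum_add_distrib]
    congr 1
    refine Finset.sum_congr rfl fun k _ => ?_
    rw [mul_assoc, dirichletKernel_mul k t hx hy hz]
    ring
  rw [← norm_mul, ← norm_mul, ← norm_mul, hK, norm_mul, norm_div, norm_one, Complex.norm_real,
    Real.norm_of_nonneg hA.le, one_div]
  have hX := hSle x (hx ▸ norm_expThird _) hx1
  have hY := hSle y (hy ▸ norm_expThird _) hy1
  have hZ := hSle z (hz ▸ norm_expThird _) hz1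
  calc _ ≤ (n : ℝ) ^ (-δ) * (36 * ‖x - 1‖ ^ (1 - δ) + 36 * ‖y - 1‖ ^ (1 - δ)
        + 36 * ‖z - 1‖ ^ (1 - δ)) := by
        gcongr
        exact norm_add₃_le.trans (by gcongr)
    _ = _ := by ring

lemma norm_expThird_sub_one (s : ℝ) :
    ‖expThird s - 1‖ = 2 * |Real.sin (Real.pi / 3 * s)| := by
  rw [expThird, Complex.norm_exp_I_mul_ofReal_sub_one, norm_mul, Real.norm_ofNat,
    Real.norm_eq_abs]
  congr 3
  ring

lemma norm_expThird_sub_one_le (s : ℝ) : ‖expThird s - 1‖ ≤ 8 / 3 * |s| := by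
  have h := Real.abs_sin_le_abs (x := Real.pi / 3 * s)
  rw [abs_mul, abs_of_pos (show 0 < Real.pi / 3 by positivity)] at h
  rw [norm_expThird_sub_one]
  nlinarith [Real.pi_le_four, abs_nonneg s]

/-- On the hexagon a difference of two coordinates is at most `2` in absolute value, so that the
argument of the sine below stays away from `±π`. -/
lemma le_norm_expThird_sub_one {s : ℝ} (hs : |s| ≤ 2) : 2 / 3 * |s| ≤ ‖expThird s - 1‖ := by
  have hpi := Real.pi_pos
  have habs : |Real.sin (Real.pi / 3 * s)| = |Real.sin (Real.pi / 3 * |s|)| := by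
    rcases abs_choice s with h | h <;> simp [h]
  rw [norm_expThird_sub_one, habs]
  have hs0 := abs_nonneg s
  generalize |s| = r at *
  rcases le_total r (3 / 2) with h | h
  · have h1 := Real.mul_le_sin (x := Real.pi / 3 * r) (by positivity) (by nlinarith)
    have h2 : 2 / Real.pi * (Real.pi / 3 * r) = 2 / 3 * r := by field_simp
    have := le_abs_self (Real.sin (Real.pi / 3 * r))
    linarith
  · have h1 := Real.mul_le_sin (x := Real.pi - Real.pi / 3 * r) (by nlinarith) (by nlinarith)
    have h2 : 2 / Real.pi * (Real.pi - Real.pi / 3 * r) = 2 - 2 / 3 * r := by field_simp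
    rw [Real.sin_pi_sub] at h1
    have := le_abs_self (Real.sin (Real.pi / 3 * r))
    linarith

/-! ### An integrable majorant -/

open scoped ENNReal

/-- A majorant, up to a constant, of the Cesàro kernel where `u` is the smallest of the three
differences of coordinates and `v` the next one in cyclic order. The first two summands carry the
trivial bound `n ^ 2`, near the line `u = 0` and near the origin; the third one carries the decay
away from them. Each is a product of a function of `u` and a function of `v`. -/
noncomputable def majorant (δ : ℝ) (n : ℕ) (u v : ℝ) : ℝ≥0∞ :=
  ENNReal.ofReal ((n : ℝ) ^ 2) *
      ((Metric.closedBall (0 : ℝ) (1 / (n : ℝ) ^ 2)).indicator 1 u *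
        (Metric.closedBall (0 : ℝ) 2).indicator 1 v) +
    ENNReal.ofReal ((n : ℝ) ^ 2) *
      ((Metric.closedBall (0 : ℝ) (4 / (n : ℝ))).indicator 1 u *
        (Metric.closedBall (0 : ℝ) (1 / (n : ℝ))).indicator 1 v) +
    ENNReal.ofReal ((n : ℝ) ^ (-δ)) *
      ({u : ℝ | |u| ∈ Set.Icc (1 / (n : ℝ) ^ 2) 2}.indicator (fun u => ENNReal.ofReal |u|⁻¹) u *
        {v : ℝ | |v| ∈ Set.Icc (1 / (n : ℝ)) 2}.indicator
          (fun v => ENNReal.ofReal (|v| ^ (-1 - δ))) v)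

lemma measurableSet_abs_mem_Icc (a b : ℝ) : MeasurableSet {u : ℝ | |u| ∈ Set.Icc a b} :=
  measurableSet_Icc.preimage measurable_norm

lemma measurable_indicator_closedBall (r : ℝ) :
    Measurable ((Metric.closedBall (0 : ℝ) r).indicator (1 : ℝ → ℝ≥0∞)) :=
  measurable_one.indicator Metric.isClosed_closedBall.measurableSet

lemma measurable_indicator_abs {g : ℝ → ℝ} (hg : Measurable g) (a b : ℝ) :
    Measurable ({u : ℝ | |u| ∈ Set.Icc a b}.indicator fun u => ENNReal.ofReal (g |u|)) :=
  (hg.comp measurable_norm).ennreal_ofReal.indicator (measurableSet_abs_mem_Icc a b)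

lemma measurable_majorant (δ : ℝ) (n : ℕ) :
    Measurable fun p : ℝ × ℝ => majorant δ n p.1 p.2 := by
  have h1 := measurable_indicator_closedBall (1 / (n : ℝ) ^ 2)
  have h2 := measurable_indicator_closedBall 2
  have h3 := measurable_indicator_closedBall (4 / (n : ℝ))
  have h4 := measurable_indicator_closedBall (1 / (n : ℝ))
  have h5 := measurable_indicator_abs measurable_inv (1 / (n : ℝ) ^ 2) 2
  have h6 := measurable_indicator_abs (measurable_id.pow_const (-1 - δ)) (1 / (n : ℝ)) 2
  exact ((((h1.comp measurable_fst).mul (h2.comp measurable_snd)).const_mul _).add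
    (((h3.comp measurable_fst).mul (h4.comp measurable_snd)).const_mul _)).add
    (((h5.comp measurable_fst).mul (h6.comp measurable_snd)).const_mul _)

lemma lintegral_indicator_abs_le {a b : ℝ} (hab : a ≤ b) {g : ℝ → ℝ}
    (hg : Measurable g) (hgc : ContinuousOn g (Set.Icc a b)) (hg0 : ∀ x ∈ Set.Icc a b, 0 ≤ g x) :
    ∫⁻ u, {u : ℝ | |u| ∈ Set.Icc a b}.indicator (fun u => ENNReal.ofReal (g |u|)) u ≤
      2 * ENNReal.ofReal (∫ u in a..b, g u) := by
  set F : ℝ → ℝ≥0∞ := (Set.Icc a b).indicator fun u => ENNReal.ofReal (g u) with hF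
  have hFm : Measurable F := hg.ennreal_ofReal.indicator measurableSet_Icc
  have hFint : ∫⁻ u, F u = ENNReal.ofReal (∫ u in a..b, g u) := by
    rw [hF, lintegral_indicator measurableSet_Icc, intervalIntegral.integral_of_le hab,
      ← integral_Icc_eq_integral_Ioc, ofReal_integral_eq_lintegral_ofReal]
    · exact hgc.integrableOn_Icc
    · exact (ae_restrict_iff' measurableSet_Icc).2 (Filter.Eventually.of_forall hg0)
  calc _ ≤ ∫⁻ u, F u + F (-u) := by
        refine lintegral_mono fun u => ?_
        by_cases hu : |u| ∈ Set.Icc a b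
        · rw [Set.indicator_of_mem (show u ∈ {u : ℝ | |u| ∈ Set.Icc a b} from hu)]
          rcases abs_choice u with h | h
          · rw [h] at hu ⊢
            exact le_add_right (by rw [hF, Set.indicator_of_mem hu])
          · rw [h] at hu ⊢
            exact le_add_left (by rw [hF, Set.indicator_of_mem hu])
        · rw [Set.indicator_of_notMem (show u ∉ {u : ℝ | |u| ∈ Set.Icc a b} from hu)]
          exact zero_le
    _ = 2 * ENNReal.ofReal (∫ u in a..b, g u) := by
        rw [lintegral_add_left hFm, lintegral_neg_eq_self, hFint, two_mul]

lemma lintegral_inv_abs_le {n : ℕ} (hn : 1 ≤ n) :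
    ∫⁻ u, {u : ℝ | |u| ∈ Set.Icc (1 / (n : ℝ) ^ 2) 2}.indicator
      (fun u => ENNReal.ofReal |u|⁻¹) u ≤ 2 * ENNReal.ofReal (3 * Real.log (n + 1)) := by
  have hn' : (1 : ℝ) ≤ n := by exact_mod_cast hn
  have ha : 0 < 1 / (n : ℝ) ^ 2 := by positivity
  have hab : 1 / (n : ℝ) ^ 2 ≤ 2 := by
    rw [div_le_iff₀ (by positivity)]; nlinarith
  refine (lintegral_indicator_abs_le hab measurable_inv
    (continuousOn_inv₀.mono fun x hx => (ha.trans_le hx.1).ne')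
    fun x hx => inv_nonneg.2 (ha.le.trans hx.1)).trans ?_
  gcongr
  rw [integral_inv_of_pos ha (by norm_num), ← Nat.cast_ofNat (R := ℝ) (n := 3), ← Real.log_pow]
  refine Real.log_le_log (by positivity) ?_
  rw [div_div_eq_mul_div, div_one]
  nlinarith

lemma lintegral_rpow_abs_le {δ : ℝ} (hδ0 : 0 < δ) {n : ℕ} (hn : 1 ≤ n) :
    ∫⁻ v, {v : ℝ | |v| ∈ Set.Icc (1 / (n : ℝ)) 2}.indicator
      (fun v => ENNReal.ofReal (|v| ^ (-1 - δ))) v ≤ 2 * ENNReal.ofReal ((n : ℝ) ^ δ / δ) := by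
  have hn' : (1 : ℝ) ≤ n := by exact_mod_cast hn
  have ha : 0 < 1 / (n : ℝ) := by positivity
  have hab : 1 / (n : ℝ) ≤ 2 := by
    rw [div_le_iff₀ (by positivity)]; linarith
  refine (lintegral_indicator_abs_le hab (measurable_id.pow_const (-1 - δ))
    (continuousOn_id.rpow_const fun x hx => Or.inl (ha.trans_le hx.1).ne')
    fun x hx => Real.rpow_nonneg (ha.le.trans hx.1) _).trans ?_
  gcongr
  simp only [id]
  rw [integral_rpow (Or.inr ⟨by linarith, fun h => ?_⟩)]
  · have e : (1 / (n : ℝ)) ^ (-δ) = (n : ℝ) ^ δ := by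
      rw [one_div, Real.inv_rpow (by positivity), Real.rpow_neg (by positivity), inv_inv]
    rw [show -1 - δ + 1 = -δ by ring, e, ← neg_div_neg_eq, neg_neg]
    gcongr
    have : (0 : ℝ) ≤ 2 ^ (-δ) := by positivity
    linarith
  · rw [Set.uIcc_of_le hab] at h
    exact absurd h.1 (not_le.2 ha)

lemma lintegral_indicator_closedBall (r : ℝ) :
    ∫⁻ u, (Metric.closedBall (0 : ℝ) r).indicator 1 u = ENNReal.ofReal (2 * r) := by
  rw [lintegral_indicator_one Metric.isClosed_closedBall.measurableSet, Real.volume_closedBall]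

lemma lintegral_fst_mul_snd {f g : ℝ → ℝ≥0∞} (hf : Measurable f) (hg : Measurable g) :
    ∫⁻ p : ℝ × ℝ, f p.1 * g p.2 = (∫⁻ u, f u) * ∫⁻ v, g v := by
  rw [Measure.volume_eq_prod]
  exact lintegral_prod_mul hf.aemeasurable hg.aemeasurable

lemma lintegral_majorant_le {δ : ℝ} (hδ0 : 0 < δ) {n : ℕ} (hn : 1 ≤ n) :
    ∫⁻ p : ℝ × ℝ, majorant δ n p.1 p.2 ≤
      ENNReal.ofReal ((48 + 12 / δ) * Real.log (n + 1)) := by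
  have hn' : (1 : ℝ) ≤ n := by exact_mod_cast hn
  have hn0 : (0 : ℝ) < n := by linarith
  have hlog : 1 / 2 ≤ Real.log (n + 1) := by
    have h1 := Real.log_two_gt_d9
    have h2 : Real.log 2 ≤ Real.log (n + 1) := Real.log_le_log (by norm_num) (by linarith)
    linarith
  have h1 := measurable_indicator_closedBall (1 / (n : ℝ) ^ 2)
  have h2 := measurable_indicator_closedBall 2
  have h3 := measurable_indicator_closedBall (4 / (n : ℝ))
  have h4 := measurable_indicator_closedBall (1 / (n : ℝ))
  have h5 := measurable_indicator_abs measurable_inv (1 / (n : ℝ) ^ 2) 2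
  have h6 := measurable_indicator_abs (measurable_id.pow_const (-1 - δ)) (1 / (n : ℝ)) 2
  have m1 := (h1.comp measurable_fst).mul (h2.comp (measurable_snd (α := ℝ)))
  have m2 := (h3.comp measurable_fst).mul (h4.comp (measurable_snd (α := ℝ)))
  have m3 := (h5.comp measurable_fst).mul (h6.comp (measurable_snd (α := ℝ)))
  have i1 := lintegral_fst_mul_snd h1 h2
  have i2 := lintegral_fst_mul_snd h3 h4
  have i3 := lintegral_fst_mul_snd h5 h6
  have j3 := (mul_le_mul' (lintegral_inv_abs_le hn) (lintegral_rpow_abs_le hδ0 hn))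
  simp only [lintegral_indicator_closedBall] at i1 i2
  have e : ∫⁻ p : ℝ × ℝ, majorant δ n p.1 p.2 = _ :=
    (lintegral_add_left ((m1.const_mul _).add (m2.const_mul _)) _).trans
      (congrArg₂ (· + ·) ((lintegral_add_left (m1.const_mul _) _).trans
        (congrArg₂ (· + ·) ((lintegral_const_mul _ m1).trans (congrArg _ i1))
          ((lintegral_const_mul _ m2).trans (congrArg _ i2))))
        ((lintegral_const_mul _ m3).trans (congrArg _ i3)))
  rw [e]
  refine (add_le_add_right (mul_le_mul_right j3 _) _).trans ?_
  have two : (2 : ℝ≥0∞) = ENNReal.ofReal 2 := by simp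
  rw [two]
  simp only [← ENNReal.ofReal_mul (show (0 : ℝ) ≤ 2 by norm_num)]
  rw [← ENNReal.ofReal_mul (by positivity), ← ENNReal.ofReal_mul (by positivity),
    ← ENNReal.ofReal_mul (by positivity), ← ENNReal.ofReal_mul (by positivity),
    ← ENNReal.ofReal_mul (by positivity), ← ENNReal.ofReal_mul (by positivity),
    ← ENNReal.ofReal_add (by positivity) (by positivity),
    ← ENNReal.ofReal_add (by positivity) (by positivity)]
  refine ENNReal.ofReal_le_ofReal ?_
  have hp : (n : ℝ) ^ (-δ) * (n : ℝ) ^ δ = 1 := by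
    rw [← Real.rpow_add hn0]; simp
  have e1 : (n : ℝ) ^ 2 * (2 * (1 / (n : ℝ) ^ 2) * (2 * 2)) = 8 := by field_simp; norm_num
  have e2 : (n : ℝ) ^ 2 * (2 * (4 / (n : ℝ)) * (2 * (1 / (n : ℝ)))) = 16 := by
    field_simp; norm_num
  have e3 : (n : ℝ) ^ (-δ) * (2 * (3 * Real.log (n + 1)) * (2 * ((n : ℝ) ^ δ / δ))) =
      12 / δ * Real.log (n + 1) := by
    linear_combination (12 / δ * Real.log (n + 1)) * hp
  rw [e1, e2, e3]
  linarith

lemma le_majorant_of_abs_le {δ : ℝ} {n : ℕ} {u v : ℝ} (hu : |u| ≤ 1 / (n : ℝ) ^ 2)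
    (hv : |v| ≤ 2) : ENNReal.ofReal ((n : ℝ) ^ 2) ≤ majorant δ n u v := by
  rw [majorant, Set.indicator_of_mem (by simpa using hu), Set.indicator_of_mem (by simpa using hv)]
  simp only [Pi.one_apply, mul_one]
  exact le_add_right (le_add_right le_rfl)

/-- With `X`, `Y`, `Z` the distances of three unimodular numbers of product `1` from `1`, and `X`
the smallest of them: `Y` and `Z` are comparable, so that the bound for the kernel reduces to
`X⁻¹ * Y ^ (-1 - δ)`. -/
lemma ofReal_le_majorant {δ : ℝ} (hδ0 : 0 < δ) (hδ1 : δ < 1) {n : ℕ} (hn : 1 ≤ n)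
    {κ u v X Y Z : ℝ} (hu : |u| ≤ 2) (hv : |v| ≤ 2) (hX0 : 0 < X) (hY0 : 0 < Y) (hZ0 : 0 < Z)
    (hXY : X ≤ Y) (hXZ : X ≤ Z) (hYle : Y ≤ Z + X) (hZle : Z ≤ X + Y)
    (huX : 2 / 3 * |u| ≤ X) (hvY : 2 / 3 * |v| ≤ Y)
    (hYv : Y ≤ 8 / 3 * |v|) (hκ0 : 0 ≤ κ) (hκ : κ ≤ 9 * (n : ℝ) ^ 2)
    (hκ' : κ * (X * Y * Z) ≤
      36 * (n : ℝ) ^ (-δ) * (X ^ (1 - δ) + Y ^ (1 - δ) + Z ^ (1 - δ))) :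
    ENNReal.ofReal κ ≤ ENNReal.ofReal 1458 * majorant δ n u v := by
  have hn' : (1 : ℝ) ≤ n := by exact_mod_cast hn
  have hn0 : (0 : ℝ) < n := by linarith
  have hsq : ENNReal.ofReal κ ≤ ENNReal.ofReal 1458 * ENNReal.ofReal ((n : ℝ) ^ 2) := by
    rw [← ENNReal.ofReal_mul (by norm_num)]
    exact ENNReal.ofReal_le_ofReal (by nlinarith)
  rcases le_or_gt |u| (1 / (n : ℝ) ^ 2) with h1 | h1
  · exact hsq.trans (mul_le_mul_right (le_majorant_of_abs_le h1 hv) _)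
  rcases le_or_gt |v| (1 / (n : ℝ)) with h2 | h2
  · -- Here `|u|` is at most `4 |v|`, hence `O(1 / n)` as well.
    refine hsq.trans (mul_le_mul_right ?_ _)
    have h3 : |u| ≤ 4 / n := by
      have : 4 / (n : ℝ) = 4 * (1 / n) := by ring
      linarith
    rw [majorant]
    refine le_add_right (le_add_left ?_)
    rw [Set.indicator_of_mem (by simpa using h3), Set.indicator_of_mem (by simpa using h2)]
    simp
  · have hu0 : 0 < |u| := lt_trans (by positivity) h1
    have hv0 : 0 < |v| := lt_trans (by positivity) h2
    have hpow : X ^ (1 - δ) + Y ^ (1 - δ) + Z ^ (1 - δ) ≤ 6 * Y ^ (1 - δ) := by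
      have hd : 0 ≤ 1 - δ := by linarith
      have a1 : X ^ (1 - δ) ≤ Y ^ (1 - δ) := Real.rpow_le_rpow hX0.le hXY hd
      have a2 : Z ^ (1 - δ) ≤ 2 * Y ^ (1 - δ) := by
        calc Z ^ (1 - δ) ≤ (2 * Y) ^ (1 - δ) := Real.rpow_le_rpow hZ0.le (by linarith) hd
          _ = 2 ^ (1 - δ) * Y ^ (1 - δ) := Real.mul_rpow (by norm_num) hY0.le
          _ ≤ 2 * Y ^ (1 - δ) := by
              gcongr
              calc (2 : ℝ) ^ (1 - δ) ≤ 2 ^ (1 : ℝ) :=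
                    Real.rpow_le_rpow_of_exponent_le (by norm_num) (by linarith)
                _ = 2 := Real.rpow_one 2
      have a3 : 0 ≤ Y ^ (1 - δ) := by positivity
      linarith
    have hY2 : Y ^ (1 - δ) = Y ^ (-1 - δ) * Y ^ 2 := by
      rw [← Real.rpow_natCast, ← Real.rpow_add hY0]
      congr 1; push_cast; ring
    have hmain : κ ≤ 432 * (n : ℝ) ^ (-δ) * (X⁻¹ * Y ^ (-1 - δ)) := by
      have b1 : κ * (X * Y * (Y / 2)) ≤ 36 * (n : ℝ) ^ (-δ) * (6 * Y ^ (1 - δ)) :=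
        calc κ * (X * Y * (Y / 2)) ≤ κ * (X * Y * Z) := by gcongr; linarith
          _ ≤ _ := hκ'
          _ ≤ _ := by gcongr
      rw [hY2] at b1
      have b2 : κ * (X * Y ^ 2) ≤
          (432 * (n : ℝ) ^ (-δ) * (X⁻¹ * Y ^ (-1 - δ))) * (X * Y ^ 2) := by
        have : (432 * (n : ℝ) ^ (-δ) * (X⁻¹ * Y ^ (-1 - δ))) * (X * Y ^ 2) =
            432 * (n : ℝ) ^ (-δ) * (Y ^ (-1 - δ) * Y ^ 2) := by field_simp
        rw [this]
        linarith
      exact le_of_mul_le_mul_right b2 (by positivity)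
    have hXinv : X⁻¹ ≤ 3 / 2 * |u|⁻¹ := by
      calc X⁻¹ ≤ (2 / 3 * |u|)⁻¹ := inv_anti₀ (by positivity) huX
        _ = 3 / 2 * |u|⁻¹ := by rw [mul_inv]; norm_num
    have hYpow : Y ^ (-1 - δ) ≤ 9 / 4 * |v| ^ (-1 - δ) := by
      calc Y ^ (-1 - δ) ≤ (2 / 3 * |v|) ^ (-1 - δ) :=
            Real.rpow_le_rpow_of_nonpos (by positivity) hvY (by linarith)
        _ = (3 / 2) ^ (1 + δ) * |v| ^ (-1 - δ) := by
            rw [Real.mul_rpow (by norm_num) hv0.le, show (2 / 3 : ℝ) = (3 / 2)⁻¹ by norm_num,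
              Real.inv_rpow (by norm_num), ← Real.rpow_neg (by norm_num)]
            congr 2; ring
        _ ≤ 9 / 4 * |v| ^ (-1 - δ) := by
            gcongr
            calc (3 / 2 : ℝ) ^ (1 + δ) ≤ (3 / 2) ^ (2 : ℝ) :=
                  Real.rpow_le_rpow_of_exponent_le (by norm_num) (by linarith)
              _ = 9 / 4 := by rw [Real.rpow_two]; norm_num
    have hfin : κ ≤ 1458 * ((n : ℝ) ^ (-δ) * (|u|⁻¹ * |v| ^ (-1 - δ))) := by
      calc κ ≤ 432 * (n : ℝ) ^ (-δ) * (X⁻¹ * Y ^ (-1 - δ)) := hmain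
        _ ≤ 432 * (n : ℝ) ^ (-δ) * ((3 / 2 * |u|⁻¹) * (9 / 4 * |v| ^ (-1 - δ))) := by gcongr
        _ = _ := by ring
    refine (ENNReal.ofReal_le_ofReal hfin).trans ?_
    rw [ENNReal.ofReal_mul (by norm_num), ENNReal.ofReal_mul (by positivity),
      ENNReal.ofReal_mul (by positivity)]
    refine mul_le_mul_right ?_ _
    rw [majorant]
    refine le_add_left ?_
    rw [Set.indicator_of_mem (show u ∈ {u : ℝ | |u| ∈ Set.Icc (1 / (n : ℝ) ^ 2) 2} from ⟨h1.le, hu⟩),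
      Set.indicator_of_mem (show v ∈ {v : ℝ | |v| ∈ Set.Icc (1 / (n : ℝ)) 2} from ⟨h2.le, hv⟩)]

/-- If `x y z = 1` on the unit circle, then `x - 1 = - x (y z - 1)`. -/
lemma norm_sub_one_le_add {x y z : ℂ} (hx : ‖x‖ = 1) (hy : ‖y‖ = 1) (h : x * y * z = 1) :
    ‖x - 1‖ ≤ ‖y - 1‖ + ‖z - 1‖ := by
  have e : x - 1 = -(x * ((y - 1) + y * (z - 1))) := by linear_combination h
  rw [e, norm_neg, norm_mul, hx, one_mul]
  refine (norm_add_le _ _).trans ?_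
  rw [norm_mul, hy, one_mul]

lemma enorm_cesaroKernel_le {δ : ℝ} (hδ0 : 0 < δ) (hδ1 : δ < 1) {n : ℕ} (hn : 1 ≤ n)
    {t : Fin 3 → ℝ} (ht : t ∈ hexagon) :
    ‖cesaroKernel δ n t‖ₑ ≤ ENNReal.ofReal 1458 *
      (majorant δ n (t 0 - t 2) (t 1 - t 0) + majorant δ n (t 1 - t 0) (t 2 - t 1) +
        majorant δ n (t 2 - t 1) (t 0 - t 2)) := by
  obtain ⟨-, ⟨h0, h0'⟩, ⟨h1, h1'⟩, h2, h2'⟩ := ht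
  have hs : (t 0 - t 2) + (t 1 - t 0) + (t 2 - t 1) = 0 := by ring
  have hu : |t 0 - t 2| ≤ 2 := abs_le.2 ⟨by linarith, by linarith⟩
  have hv : |t 1 - t 0| ≤ 2 := abs_le.2 ⟨by linarith, by linarith⟩
  have hw : |t 2 - t 1| ≤ 2 := abs_le.2 ⟨by linarith, by linarith⟩
  have hκ := norm_cesaroKernel_le_sq hδ0 hn t
  have hκ' := norm_cesaroKernel_mul_le hδ0 hδ1 hn t rfl rfl rfl
  rw [← ofReal_norm]
  have hκ0 := norm_nonneg (cesaroKernel δ n t)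
  generalize ‖cesaroKernel δ n t‖ = κ at *
  generalize t 0 - t 2 = u at *
  generalize t 1 - t 0 = v at *
  generalize t 2 - t 1 = w at *
  -- On a line where two coordinates agree only the trivial bound is available.
  have triv : ∀ a b : ℝ, a = 0 → |b| ≤ 2 →
      ENNReal.ofReal κ ≤ ENNReal.ofReal 1458 * majorant δ n a b := by
    intro a b ha hb
    refine le_trans ?_ (mul_le_mul_right (le_majorant_of_abs_le
      (by rw [ha, abs_zero]; positivity) hb) _)
    rw [← ENNReal.ofReal_mul (by norm_num)]
    exact ENNReal.ofReal_le_ofReal (by nlinarith [sq_nonneg (n : ℝ)])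
  have hxyz := expThird_mul_mul hs
  have tx := norm_sub_one_le_add (norm_expThird u) (norm_expThird v) hxyz
  have ty := norm_sub_one_le_add (norm_expThird v) (norm_expThird w)
    (x := expThird v) (z := expThird u) (by rw [← hxyz]; ring)
  have tz := norm_sub_one_le_add (norm_expThird w) (norm_expThird u)
    (x := expThird w) (z := expThird v) (by rw [← hxyz]; ring)
  have lu := le_norm_expThird_sub_one hu
  have lv := le_norm_expThird_sub_one hv
  have lw := le_norm_expThird_sub_one hw
  have rx := norm_expThird_sub_one_le u
  have ry := norm_expThird_sub_one_le v
  have rz := norm_expThird_sub_one_le w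
  suffices h : ENNReal.ofReal κ ≤ ENNReal.ofReal 1458 * majorant δ n u v ∨
      ENNReal.ofReal κ ≤ ENNReal.ofReal 1458 * majorant δ n v w ∨
      ENNReal.ofReal κ ≤ ENNReal.ofReal 1458 * majorant δ n w u by
    rcases h with h | h | h
    · exact h.trans (mul_le_mul_right (le_add_right (le_add_right le_rfl)) _)
    · exact h.trans (mul_le_mul_right (le_add_right (le_add_left le_rfl)) _)
    · exact h.trans (mul_le_mul_right (le_add_left le_rfl) _)
  by_cases hu0 : u = 0
  · exact Or.inl (triv u v hu0 hv)
  by_cases hv0 : v = 0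
  · exact Or.inr (Or.inl (triv v w hv0 hw))
  by_cases hw0 : w = 0
  · exact Or.inr (Or.inr (triv w u hw0 hu))
  have pos : ∀ a : ℝ, a ≠ 0 → 2 / 3 * |a| ≤ ‖expThird a - 1‖ → 0 < ‖expThird a - 1‖ :=
    fun a ha h => lt_of_lt_of_le (by positivity) h
  have pu := pos u hu0 lu
  have pv := pos v hv0 lv
  have pw := pos w hw0 lw
  have hκ'' := hκ' (sub_ne_zero.1 (norm_pos_iff.1 pu)) (sub_ne_zero.1 (norm_pos_iff.1 pv))
    (sub_ne_zero.1 (norm_pos_iff.1 pw))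
  clear hκ'
  generalize ‖expThird u - 1‖ = X at *
  generalize ‖expThird v - 1‖ = Y at *
  generalize ‖expThird w - 1‖ = Z at *
  by_cases hX : X ≤ Y ∧ X ≤ Z
  · exact Or.inl (ofReal_le_majorant hδ0 hδ1 hn hu hv pu pv pw hX.1 hX.2 (by linarith)
      (by linarith) lu lv ry hκ0 hκ hκ'')
  by_cases hY : Y ≤ Z ∧ Y ≤ X
  · exact Or.inr (Or.inl (ofReal_le_majorant hδ0 hδ1 hn hv hw pv pw pu hY.1 hY.2 (by linarith)
      (by linarith) lv lw rz hκ0 hκ (by linarith)))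
  have hZ : Z ≤ X ∧ Z ≤ Y := by
    constructor
    · by_contra hc
      exact hX ⟨by by_contra h; exact hY ⟨by linarith, by linarith⟩, by linarith⟩
    · by_contra hc
      exact hY ⟨by linarith, by by_contra h; exact hX ⟨by linarith, by linarith⟩⟩
  exact Or.inr (Or.inr (ofReal_le_majorant hδ0 hδ1 hn hw hu pw pu pv hZ.1 hZ.2 (by linarith)
    (by linarith) lw lu rx hκ0 hκ (by linarith)))

/-! ### Integration over the hexagon -/

lemma exists_lintegral_comp_linearEquiv (L : (ℝ × ℝ) ≃ₗ[ℝ] ℝ × ℝ) :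
    ∃ c : ℝ, 0 ≤ c ∧ ∀ f : ℝ × ℝ → ℝ≥0∞, Measurable f →
      ∫⁻ p, f (L p) = ENNReal.ofReal c * ∫⁻ p, f p := by
  refine ⟨|(LinearMap.det (L : (ℝ × ℝ) →ₗ[ℝ] ℝ × ℝ))⁻¹|, abs_nonneg _, fun f hf => ?_⟩
  have hL : Measurable (L : (ℝ × ℝ) →ₗ[ℝ] ℝ × ℝ) :=
    (LinearMap.continuous_of_finiteDimensional _).measurable
  have h := Measure.map_linearMap_addHaar_eq_smul_addHaar (volume : Measure (ℝ × ℝ))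
    (f := (L : (ℝ × ℝ) →ₗ[ℝ] ℝ × ℝ)) L.isUnit_det'.ne_zero
  calc ∫⁻ p, f (L p) = ∫⁻ p, f p ∂(volume.map (L : (ℝ × ℝ) →ₗ[ℝ] ℝ × ℝ)) :=
        (lintegral_map hf hL).symm
    _ = _ := by rw [h, lintegral_smul_measure, smul_eq_mul]

/-- The coordinates `(t₁ - t₃, t₂ - t₁)` on the plane `t₁ + t₂ + t₃ = 0`, in terms of
`(t₁, t₂)`. -/
noncomputable def differenceEquiv : (ℝ × ℝ) ≃ₗ[ℝ] ℝ × ℝ where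
  toFun p := (2 * p.1 + p.2, p.2 - p.1)
  invFun q := ((q.1 - q.2) / 3, (q.1 + 2 * q.2) / 3)
  map_add' p q := by ext <;> simp <;> ring
  map_smul' c p := by ext <;> simp <;> ring
  left_inv p := by ext <;> simp <;> ring
  right_inv q := by ext <;> simp <;> ring

/-- The cyclic rotation `(u, v) ↦ (v, w)` of three numbers with `u + v + w = 0`. -/
def rotationEquiv : (ℝ × ℝ) ≃ₗ[ℝ] ℝ × ℝ where
  toFun p := (p.2, -p.1 - p.2)
  invFun q := (-q.1 - q.2, q.1)
  map_add' p q := by ext <;> simp; ring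
  map_smul' c p := by ext <;> simp; ring
  left_inv p := by ext <;> simp; ring
  right_inv q := by ext <;> simp

lemma measurableSet_hexagon : MeasurableSet hexagon := by
  unfold hexagon
  measurability

lemma continuous_cesaroKernel (δ : ℝ) (n : ℕ) : Continuous (cesaroKernel δ n) := by
  unfold cesaroKernel dirichletKernel phi
  fun_prop

lemma setLIntegral_hexagon_le {f : (Fin 3 → ℝ) → ℝ≥0∞} (hf : Measurable f) {g : ℝ × ℝ → ℝ≥0∞}
    (hfg : ∀ t ∈ hexagon, f t ≤ g (t 0, t 1)) :
    ∫⁻ t in hexagon, f t ∂planeMeasure ≤ ∫⁻ p, g p := by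
  have hm : Measurable fun p : ℝ × ℝ => ![p.1, p.2, -p.1 - p.2] := by
    refine measurable_pi_iff.2 fun i => ?_
    fin_cases i
    · exact measurable_fst
    · exact measurable_snd
    · exact measurable_fst.neg.sub measurable_snd
  rw [planeMeasure, setLIntegral_map measurableSet_hexagon hf hm]
  refine (setLIntegral_mono_ae' (hm measurableSet_hexagon)
    (Filter.Eventually.of_forall fun p hp => ?_)).trans (setLIntegral_le_lintegral _ _)
  exact hfg _ hp

lemma exists_lintegral_cesaroKernel_le {δ : ℝ} (hδ0 : 0 < δ) (hδ1 : δ < 1) :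
    ∃ C : ℝ, 0 < C ∧ ∀ n : ℕ, 1 ≤ n →
      ∫⁻ t in hexagon, ‖cesaroKernel δ n t‖ₑ ∂planeMeasure ≤
        ENNReal.ofReal (C * Real.log (n + 1)) := by
  obtain ⟨c₁, hc₁, H₁⟩ := exists_lintegral_comp_linearEquiv differenceEquiv
  obtain ⟨c₂, hc₂, H₂⟩ := exists_lintegral_comp_linearEquiv (differenceEquiv.trans rotationEquiv)
  obtain ⟨c₃, hc₃, H₃⟩ := exists_lintegral_comp_linearEquiv
    ((differenceEquiv.trans rotationEquiv).trans rotationEquiv)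
  refine ⟨1458 * (c₁ + c₂ + c₃) * (48 + 12 / δ) + 1, by positivity, fun n hn => ?_⟩
  have hlog : 0 ≤ Real.log ((n : ℝ) + 1) := Real.log_nonneg (by linarith [n.cast_nonneg (α := ℝ)])
  set M : ℝ × ℝ → ℝ≥0∞ := fun p => majorant δ n p.1 p.2 with hM
  have hMm : Measurable M := measurable_majorant δ n
  have meas : ∀ L : (ℝ × ℝ) ≃ₗ[ℝ] ℝ × ℝ, Measurable fun p => M (L p) := fun L =>
    hMm.comp (LinearMap.continuous_of_finiteDimensional (L : (ℝ × ℝ) →ₗ[ℝ] ℝ × ℝ)).measurable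
  calc ∫⁻ t in hexagon, ‖cesaroKernel δ n t‖ₑ ∂planeMeasure
      ≤ ∫⁻ p, ENNReal.ofReal 1458 * (M (differenceEquiv p) +
          M ((differenceEquiv.trans rotationEquiv) p) +
          M (((differenceEquiv.trans rotationEquiv).trans rotationEquiv) p)) := by
        refine setLIntegral_hexagon_le (continuous_cesaroKernel δ n).enorm.measurable
          fun t ht => (enorm_cesaroKernel_le hδ0 hδ1 hn ht).trans (le_of_eq ?_)
        have h2 : t 2 = -t 0 - t 1 := by linarith [ht.1]
        have hu : t 0 - t 2 = 2 * t 0 + t 1 := by rw [h2]; ring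
        have hw : t 2 - t 1 = -(2 * t 0 + t 1) - (t 1 - t 0) := by rw [h2]; ring
        have hr : -(t 1 - t 0) - (-(2 * t 0 + t 1) - (t 1 - t 0)) = 2 * t 0 + t 1 := by ring
        simp only [hM, differenceEquiv, rotationEquiv, LinearEquiv.trans_apply, LinearEquiv.coe_mk,
          LinearMap.coe_mk, AddHom.coe_mk, hu, hw, hr]
    _ = ENNReal.ofReal 1458 * ((ENNReal.ofReal c₁ + ENNReal.ofReal c₂ + ENNReal.ofReal c₃) *
          ∫⁻ p, M p) := by
        rw [lintegral_const_mul' _ _ ENNReal.ofReal_ne_top, lintegral_add_right _ (meas _),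
          lintegral_add_right _ (meas _), H₁ M hMm, H₂ M hMm, H₃ M hMm, add_mul, add_mul]
    _ ≤ ENNReal.ofReal 1458 * ((ENNReal.ofReal c₁ + ENNReal.ofReal c₂ + ENNReal.ofReal c₃) *
          ENNReal.ofReal ((48 + 12 / δ) * Real.log (n + 1))) := by
        gcongr
        exact lintegral_majorant_le hδ0 hn
    _ ≤ _ := by
        rw [← ENNReal.ofReal_add hc₁ hc₂, ← ENNReal.ofReal_add (by positivity) hc₃,
          ← ENNReal.ofReal_mul (by positivity), ← ENNReal.ofReal_mul (by norm_num)]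
        refine ENNReal.ofReal_le_ofReal ?_
        linarith

end HexagonalFourier

theorem theorem2 (δ : ℝ) (hδ0 : 0 < δ) (hδ1 : δ < 1) :
    ∃ C : ℝ, 0 < C ∧ ∀ n : ℕ, 1 ≤ n →
      IntegrableOn (HexagonalFourier.cesaroKernel δ n) HexagonalFourier.hexagon
        HexagonalFourier.planeMeasure ∧
      ∫ t in HexagonalFourier.hexagon, ‖HexagonalFourier.cesaroKernel δ n t‖
        ∂HexagonalFourier.planeMeasure ≤ C * Real.log ((n : ℝ) + 1) := by
  obtain ⟨C, hC, h⟩ := HexagonalFourier.exists_lintegral_cesaroKernel_le hδ0 hδ1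
  refine ⟨C, hC, fun n hn => ?_⟩
  have hlog : 0 ≤ Real.log ((n : ℝ) + 1) := Real.log_nonneg (by linarith [n.cast_nonneg (α := ℝ)])
  have hm : AEStronglyMeasurable (HexagonalFourier.cesaroKernel δ n)
      (HexagonalFourier.planeMeasure.restrict HexagonalFourier.hexagon) :=
    (HexagonalFourier.continuous_cesaroKernel δ n).aestronglyMeasurable
  refine ⟨⟨hm, (h n hn).trans_lt ENNReal.ofReal_lt_top⟩, ?_⟩
  rw [integral_norm_eq_lintegral_enorm hm]
  exact ENNReal.toReal_le_of_le_ofReal (by positivity) (h n hn)
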